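/- Let $M=(M_p)_{p\in\mathbb{N}_0}$ be a weight sequence, that is, a sequence of positive real numbers with $M_0=1$ which is log-convex ($M_p^2\le M_{p-1}M_{p+1}$ for $p\ge 1$) and whose quotients $m_p:=M_{p+1}/M_p$ tend to infinity. Assume that $\gamma(M)>0$, where $$\gamma(M):=\sup\{\mu>0 : (m_p/(p+1)^\mu)_p \text{ is almost increasing}\}\in[0,\infty]$$ (with $\sup\emptyset:=0$; a sequence $(c_p)_p$ is almost increasing if there is $a>0$ with $c_p\le a\,c_q$ for all $q\ge p$). Let $C_{\{M\}}(0,\infty)$ be the space of all continuous $\varphi:(0,\infty)\to\mathbb{C}$ such that $$\sup_{p\in\mathbb{N}_0}\sup_{x>0}\frac{x^p|\varphi(x)|}{h^pM_p}<\infty\quad\text{for some } h>0,$$ and let $\Lambda_{\{M_{+1}\}}$ be the space of all complex sequences $(c_p)_{p\in\mathbb{N}_0}$ such that $\sup_{p\in\mathbb{N}_0}|c_p|/(h^pM_{p+1})<\infty$ for some $h>0$. Then, for every $\varphi\in C_{\{M\}}(0,\infty)$, the moments $\mu_p(\varphi):=\int_0^\infty x^p\varphi(x)\,dx$, $p\in\mathbb{N}_0$,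 converge absolutely, and the moment mapping $\mathcal{M}(\varphi):=(\mu_p(\varphi))_{p\in\mathbb{N}_0}$ satisfies $$\mathcal{M}\big(C_{\{M\}}(0,\infty)\big)\subset\Lambda_{\{M_{+1}\}}$$ if and only if $M$ has shifted moments (sm), i.e., there exist $C_0>0$ and $H>1$ such that $\log(m_{p+1}/m_p)\le C_0H^{p+1}$ for all $p\in\mathbb{N}_0$. -/

import Mathlib

noncomputable section

namespace StieltjesMoment

open Set Filter MeasureTheory

/-- The sequence of quotients `m_p = M_{p+1} / M_p` of a sequence `M`. -/
def quot (M : ℕ → ℝ) (p : ℕ) : ℝ := M (p + 1) / M p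

/-- The forward shift `M_{+1} = (M_{p+1})_p` of a sequence `M`. -/
def shift (M : ℕ → ℝ) (p : ℕ) : ℝ := M (p + 1)

/-- A weight sequence: a sequence of positive reals with `M_0 = 1` that is log-convex and whose
sequence of quotients tends to infinity. -/
structure IsWeightSequence (M : ℕ → ℝ) : Prop where
  pos : ∀ p, 0 < M p
  zero_eq_one : M 0 = 1
  logConvex : ∀ p, M (p + 1) ^ 2 ≤ M p * M (p + 2)
  tendsto_quot : Tendsto (quot M) atTop atTop

/-- Condition (sm): `M` has shifted moments. -/
def HasShiftedMoments (M : ℕ → ℝ) : Prop :=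
  ∃ C₀ : ℝ, ∃ H : ℝ, 0 < C₀ ∧ 1 < H ∧
    ∀ p : ℕ, Real.log (quot M (p + 1) / quot M p) ≤ C₀ * H ^ (p + 1)

/-- A real sequence `c` is almost increasing if, for some `a > 0`, `c_p ≤ a c_q` for `p ≤ q`. -/
def AlmostIncreasing (c : ℕ → ℝ) : Prop :=
  ∃ a : ℝ, 0 < a ∧ ∀ p q : ℕ, p ≤ q → c p ≤ a * c q

/-- The index `γ(M) ∈ [0, ∞]`: the supremum of all `μ > 0` for which `(m_p / (p+1)^μ)_p` is almost
increasing (and `0` if there is none). -/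
def gammaIndex (M : ℕ → ℝ) : ENNReal :=
  sSup (ENNReal.ofReal ''
    {μ : ℝ | 0 < μ ∧ AlmostIncreasing fun p : ℕ => quot M p / ((p : ℝ) + 1) ^ μ})

/-- The space `C_{M,h}(0,∞)` of continuous functions `φ : (0,∞) → ℂ` such that
`x^p |φ(x)| / (h^p M_p)` is bounded in `p ∈ ℕ` and `x > 0`. A function on `(0,∞)` is represented
by a function on `ℝ` whose values outside `(0,∞)` play no role. -/
def spaceCh (M : ℕ → ℝ) (h : ℝ) : Set (ℝ → ℂ) :=
  {φ | ContinuousOn φ (Ioi 0) ∧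
    ∃ C : ℝ, ∀ p : ℕ, ∀ x ∈ Ioi (0 : ℝ), x ^ p * ‖φ x‖ / (h ^ p * M p) ≤ C}

/-- The space `C_{{M}}(0,∞)`, the union over `h > 0` of the spaces `C_{M,h}(0,∞)`. -/
def spaceC (M : ℕ → ℝ) : Set (ℝ → ℂ) := ⋃ h ∈ Ioi (0 : ℝ), spaceCh M h

/-- The space `Λ_{M,h}` of complex sequences `c` such that `|c_p| / (h^p M_p)` is bounded. -/
def spaceLambdah (M : ℕ → ℝ) (h : ℝ) : Set (ℕ → ℂ) :=
  {c | ∃ C : ℝ, ∀ p : ℕ, ‖c p‖ / (h ^ p * M p) ≤ C}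

/-- The space `Λ_{{M}}`, the union over `h > 0` of the spaces `Λ_{M,h}`. -/
def spaceLambda (M : ℕ → ℝ) : Set (ℕ → ℂ) := ⋃ h ∈ Ioi (0 : ℝ), spaceLambdah M h

/-- The Stieltjes moment mapping `φ ↦ (∫₀^∞ x^p φ(x) dx)_p`. -/
def momentMap (φ : ℝ → ℂ) (p : ℕ) : ℂ := ∫ x in Ioi (0 : ℝ), (x : ℂ) ^ p * φ x

end StieltjesMoment

end

/-!
Write `m = quot M`; log-convexity says that `m` is nondecreasing.

If `φ` satisfies `x ^ q * ‖φ x‖ ≤ C * h ^ q * M q` for all `q`, the integral of `x ^ p * ‖φ x‖` is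
estimated with `q = p` on `(0, h * m p]`, with `q = p + 1` on `(h * m p, h * m (p + 1)]` and with
`q = p + 2` beyond. The outer pieces are each at most `C * h ^ (p + 1) * M (p + 1)`, and the middle
one is at most `log (m (p + 1) / m p)` times this (`integrableOn_and_norm_momentMap_le`). So
moments always exist, and (sm), which bounds the logarithm geometrically, puts them in
`Λ_{{M_{+1}}}`.

Conversely, the largest function with `x ^ q * φ x ≤ M q` for all `q` and `x > 0` is
`φ x = (sup_q x ^ q / M q)⁻¹`. It is continuous, since the supremum is a positive convex function.
On `[m p, m (p + 1)]` the supremum is attained at `q = p + 1`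
(`pow_div_le_of_quot_le_of_le_quot`), so the `p`-th moment of `φ` is at least
`∫ M (p + 1) / x = M (p + 1) * log (m (p + 1) / m p)` over this interval, and (sm) is forced by
this single function.
-/

namespace StieltjesMoment

open Set Filter MeasureTheory

/-! ### Quotients of a weight sequence -/

section WeightSequence

variable {M : ℕ → ℝ}

lemma IsWeightSequence.quot_pos (hM : IsWeightSequence M) (p : ℕ) : 0 < quot M p :=
  div_pos (hM.pos _) (hM.pos _)

lemma IsWeightSequence.mul_quot (hM : IsWeightSequence M) (p : ℕ) :
    M p * quot M p = M (p + 1) :=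
  mul_div_cancel₀ _ (hM.pos p).ne'

lemma IsWeightSequence.monotone_quot (hM : IsWeightSequence M) : Monotone (quot M) := by
  refine monotone_nat_of_le_succ fun p => ?_
  rw [quot, quot, div_le_div_iff₀ (hM.pos _) (hM.pos _)]
  linarith [hM.logConvex p]

/-- The maximal term of `(x ^ q / M q)_q` is the one at the index where the quotients pass `x`. -/
lemma IsWeightSequence.pow_div_le_of_quot_le_of_le_quot (hM : IsWeightSequence M) {x : ℝ}
    (hx : 0 < x) {n : ℕ} (hlt : ∀ k < n, quot M k ≤ x) (hge : ∀ k, n ≤ k → x ≤ quot M k) (q : ℕ) :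
    x ^ q / M q ≤ x ^ n / M n := by
  rcases le_total n q with hnq | hqn
  · induction q, hnq using Nat.le_induction with
    | base => exact le_rfl
    | succ q hnq ih =>
      refine le_trans ?_ ih
      rw [div_le_div_iff₀ (hM.pos _) (hM.pos _), ← hM.mul_quot q, pow_succ]
      have h : 0 ≤ x ^ q * M q := (mul_pos (pow_pos hx q) (hM.pos q)).le
      nlinarith [mul_le_mul_of_nonneg_left (hge q hnq) h]
  · have key : ∀ j, q ≤ j → j ≤ n → x ^ q / M q ≤ x ^ j / M j := by
      intro j hj
      induction j, hj using Nat.le_induction with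
      | base => exact fun _ => le_rfl
      | succ j hj ihj =>
        intro hjn
        refine (ihj (by omega)).trans ?_
        rw [div_le_div_iff₀ (hM.pos _) (hM.pos _), ← hM.mul_quot j, pow_succ]
        have h : 0 ≤ x ^ j * M j := (mul_pos (pow_pos hx j) (hM.pos j)).le
        nlinarith [mul_le_mul_of_nonneg_left (hlt j (by omega)) h]
    exact key n hqn le_rfl

end WeightSequence

/-! ### Moments of rapidly decreasing functions -/

section Upper

lemma integral_Ioi_inv_sq {b : ℝ} (hb : 0 < b) :
    IntegrableOn (fun x : ℝ => (x ^ 2)⁻¹) (Ioi b) ∧ ∫ x in Ioi b, (x ^ 2)⁻¹ = b⁻¹ := by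
  have hfun : ∀ x ∈ Ioi b, x ^ (-2 : ℝ) = (x ^ 2)⁻¹ := fun x hx => by
    rw [Real.rpow_neg (hb.trans hx).le]; norm_cast
  refine ⟨(integrableOn_Ioi_rpow_of_lt (by norm_num : (-2 : ℝ) < -1) hb).congr_fun hfun
    measurableSet_Ioi, ?_⟩
  rw [← setIntegral_congr_fun measurableSet_Ioi hfun, integral_Ioi_rpow_of_lt (by norm_num) hb]
  have : (-2 : ℝ) + 1 = -1 := by norm_num
  rw [this, Real.rpow_neg_one]
  ring

lemma integrableOn_and_norm_integral_Ioi_le {f : ℝ → ℂ} {a b A B D : ℝ} (ha : 0 < a)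
    (hab : a ≤ b) (hf : ContinuousOn f (Ioi 0)) (hA : ∀ x ∈ Ioi (0 : ℝ), ‖f x‖ ≤ A)
    (hB : ∀ x ∈ Ioi (0 : ℝ), x * ‖f x‖ ≤ B) (hD : ∀ x ∈ Ioi (0 : ℝ), x ^ 2 * ‖f x‖ ≤ D) :
    IntegrableOn f (Ioi 0) ∧
      ‖∫ x in Ioi (0 : ℝ), f x‖ ≤ A * a + B * Real.log (b / a) + D * b⁻¹ := by
  have hb : 0 < b := ha.trans_le hab
  have hmeas : ∀ s ⊆ Ioi (0 : ℝ), MeasurableSet s → AEStronglyMeasurable f (volume.restrict s) :=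
    fun s hs hsm => (hf.mono hs).aestronglyMeasurable hsm
  have hs1 : Ioc 0 a ⊆ Ioi (0 : ℝ) := fun x hx => hx.1
  have hs2 : Ioc a b ⊆ Ioi (0 : ℝ) := fun x hx => ha.trans hx.1
  have hs3 : Ioi b ⊆ Ioi (0 : ℝ) := fun x hx => hb.trans hx
  have hle2 : ∀ x ∈ Ioc a b, ‖f x‖ ≤ B * x⁻¹ := fun x hx => by
    rw [← div_eq_mul_inv, le_div_iff₀ (hs2 hx), mul_comm]; exact hB x (hs2 hx)
  have hle3 : ∀ x ∈ Ioi b, ‖f x‖ ≤ D * (x ^ 2)⁻¹ := fun x hx => by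
    rw [← div_eq_mul_inv, le_div_iff₀ (pow_pos (hs3 hx) 2), mul_comm]; exact hD x (hs3 hx)
  have hg1 : IntegrableOn (fun _ : ℝ => A) (Ioc 0 a) := integrableOn_const (by simp)
  have hg2 : IntegrableOn (fun x : ℝ => B * x⁻¹) (Ioc a b) := by
    refine (ContinuousOn.integrableOn_Icc ?_).mono_set Ioc_subset_Icc_self
    exact continuousOn_const.mul (continuousOn_id.inv₀ fun x hx => (ha.trans_le hx.1).ne')
  have hg3 : IntegrableOn (fun x : ℝ => D * (x ^ 2)⁻¹) (Ioi b) :=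
    (integral_Ioi_inv_sq hb).1.const_mul D
  have hd1 := ae_restrict_of_forall_mem (μ := volume) measurableSet_Ioc
    fun x (hx : x ∈ Ioc 0 a) => hA x (hs1 hx)
  have hd2 := ae_restrict_of_forall_mem (μ := volume) measurableSet_Ioc hle2
  have hd3 := ae_restrict_of_forall_mem (μ := volume) measurableSet_Ioi hle3
  have hi1 : IntegrableOn f (Ioc 0 a) := hg1.mono' (hmeas _ hs1 measurableSet_Ioc) hd1
  have hi2 : IntegrableOn f (Ioc a b) := hg2.mono' (hmeas _ hs2 measurableSet_Ioc) hd2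
  have hi3 : IntegrableOn f (Ioi b) := hg3.mono' (hmeas _ hs3 measurableSet_Ioi) hd3
  have hi23 : IntegrableOn f (Ioi a) := Ioc_union_Ioi_eq_Ioi hab ▸ hi2.union hi3
  refine ⟨Ioc_union_Ioi_eq_Ioi ha.le ▸ hi1.union hi23, ?_⟩
  have hn1 := norm_integral_le_of_norm_le hg1 hd1
  have hn2 := norm_integral_le_of_norm_le hg2 hd2
  have hn3 := norm_integral_le_of_norm_le hg3 hd3
  have hlog : ∫ x in Ioc a b, x⁻¹ = Real.log (b / a) := by
    rw [← intervalIntegral.integral_of_le hab, integral_inv_of_pos ha hb]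
  rw [integral_const_mul, hlog] at hn2
  rw [integral_const_mul, (integral_Ioi_inv_sq hb).2] at hn3
  have hc : ∫ _ in Ioc 0 a, A = A * a := by
    rw [← intervalIntegral.integral_of_le ha.le]; simp [mul_comm]
  rw [hc] at hn1
  rw [← Ioc_union_Ioi_eq_Ioi ha.le, setIntegral_union (Ioc_disjoint_Ioi le_rfl) measurableSet_Ioi
    hi1 hi23, ← Ioc_union_Ioi_eq_Ioi hab, setIntegral_union (Ioc_disjoint_Ioi le_rfl)
    measurableSet_Ioi hi2 hi3, ← add_assoc]
  exact norm_add₃_le.trans (by gcongr)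

/-- The cut points `h * m p` and `h * m (p + 1)` are those at which consecutive weight bounds on
`φ` coincide. -/
lemma integrableOn_and_norm_momentMap_le {M : ℕ → ℝ} (hM : IsWeightSequence M) {φ : ℝ → ℂ}
    (hφ : ContinuousOn φ (Ioi 0)) {h C : ℝ} (hh : 0 < h)
    (hC : ∀ p : ℕ, ∀ x ∈ Ioi (0 : ℝ), x ^ p * ‖φ x‖ / (h ^ p * M p) ≤ C) (p : ℕ) :
    IntegrableOn (fun x : ℝ => (x : ℂ) ^ p * φ x) (Ioi 0) ∧
      ‖momentMap φ p‖ ≤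
        C * h ^ (p + 1) * M (p + 1) * (2 + Real.log (quot M (p + 1) / quot M p)) := by
  have hbound : ∀ q : ℕ, ∀ x ∈ Ioi (0 : ℝ), x ^ q * ‖φ x‖ ≤ C * (h ^ q * M q) := fun q x hx =>
    (div_le_iff₀ (mul_pos (pow_pos hh q) (hM.pos q))).1 (hC q x hx)
  have hnorm : ∀ x ∈ Ioi (0 : ℝ), ‖(x : ℂ) ^ p * φ x‖ = x ^ p * ‖φ x‖ := fun x hx => by
    rw [norm_mul, norm_pow, Complex.norm_of_nonneg (le_of_lt hx)]
  have hm := hM.quot_pos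
  have key := integrableOn_and_norm_integral_Ioi_le (f := fun x : ℝ => (x : ℂ) ^ p * φ x)
    (a := h * quot M p) (b := h * quot M (p + 1)) (A := C * (h ^ p * M p))
    (B := C * (h ^ (p + 1) * M (p + 1))) (D := C * (h ^ (p + 2) * M (p + 2)))
    (mul_pos hh (hm p))
    (mul_le_mul_of_nonneg_left (hM.monotone_quot p.le_succ) hh.le)
    ((Complex.continuous_ofReal.pow p).continuousOn.mul hφ)
    (fun x hx => by rw [hnorm x hx]; exact hbound p x hx)
    (fun x hx => by rw [hnorm x hx, ← mul_assoc, ← pow_succ']; exact hbound (p + 1) x hx)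
    (fun x hx => by
      rw [hnorm x hx, ← mul_assoc, ← pow_add, add_comm]; exact hbound (p + 2) x hx)
  refine ⟨key.1, key.2.trans_eq ?_⟩
  rw [mul_div_mul_left _ _ hh.ne', ← hM.mul_quot (p + 1), ← hM.mul_quot p]
  have := (hm (p + 1)).ne'
  have := hh.ne'
  field_simp
  ring

lemma momentMap_mem_spaceLambda {M : ℕ → ℝ} (hM : IsWeightSequence M)
    (hsm : HasShiftedMoments M) {φ : ℝ → ℂ} (hφ : φ ∈ spaceC M) :
    momentMap φ ∈ spaceLambda (shift M) := by
  obtain ⟨C₀, H, hC₀, hH, hsm⟩ := hsm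
  simp only [spaceC, mem_iUnion] at hφ
  obtain ⟨h, hh, hcont, C, hC⟩ := hφ
  have hh : 0 < h := hh
  have hH0 : 0 < H := one_pos.trans hH
  have hC0 : 0 ≤ C := le_trans (div_nonneg (mul_nonneg (by positivity) (norm_nonneg _))
    (mul_pos (pow_pos hh 0) (hM.pos 0)).le) (hC 0 1 (mem_Ioi.2 one_pos))
  simp only [spaceLambda, mem_iUnion]
  refine ⟨h * H, mul_pos hh hH0, C * h * (2 + C₀) * H, fun p => ?_⟩
  have hM1 := hM.pos (p + 1)
  rw [shift, div_le_iff₀ (by positivity)]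
  refine (integrableOn_and_norm_momentMap_le hM hcont hh hC p).2.trans ?_
  have h1 : 1 ≤ H ^ (p + 1) := one_le_pow₀ hH.le
  calc C * h ^ (p + 1) * M (p + 1) * (2 + Real.log (quot M (p + 1) / quot M p))
      ≤ C * h ^ (p + 1) * M (p + 1) * ((2 + C₀) * H ^ (p + 1)) := by
        gcongr
        linarith [hsm p]
    _ = C * h * (2 + C₀) * H * ((h * H) ^ p * M (p + 1)) := by ring

end Upper

/-! ### The extremal function -/

section Lower

variable {M : ℕ → ℝ}

/-- The supremum of the terms `x ^ q / M q`, that is, the exponential of the function usually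
associated with `M`. It is meaningful for `x > 0`, where the terms are bounded. -/
noncomputable def maximalTerm (M : ℕ → ℝ) (x : ℝ) : ℝ := ⨆ q : ℕ, x ^ q / M q

lemma IsWeightSequence.bddAbove_pow_div (hM : IsWeightSequence M) {x : ℝ} (hx : 0 < x) :
    BddAbove (range fun q : ℕ => x ^ q / M q) := by
  classical
  have hex : ∃ n, x ≤ quot M n := (hM.tendsto_quot.eventually_ge_atTop x).exists
  refine ⟨x ^ Nat.find hex / M (Nat.find hex), ?_⟩
  rintro _ ⟨q, rfl⟩
  exact hM.pow_div_le_of_quot_le_of_le_quot hx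
    (fun k hk => (not_le.1 (Nat.find_min hex hk)).le)
    (fun k hk => (Nat.find_spec hex).trans (hM.monotone_quot hk)) q

lemma IsWeightSequence.pow_div_le_maximalTerm (hM : IsWeightSequence M) {x : ℝ} (hx : 0 < x)
    (q : ℕ) : x ^ q / M q ≤ maximalTerm M x :=
  le_ciSup (hM.bddAbove_pow_div hx) q

lemma IsWeightSequence.maximalTerm_pos (hM : IsWeightSequence M) {x : ℝ} (hx : 0 < x) :
    0 < maximalTerm M x :=
  (div_pos (pow_pos hx 0) (hM.pos 0)).trans_le (hM.pow_div_le_maximalTerm hx 0)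

lemma IsWeightSequence.continuousOn_maximalTerm (hM : IsWeightSequence M) :
    ContinuousOn (maximalTerm M) (Ioi 0) := by
  refine ConvexOn.continuousOn isOpen_Ioi ⟨convex_Ioi 0, ?_⟩
  intro x hx y hy a b ha hb hab
  refine ciSup_le fun q => ?_
  have hconv := (convexOn_pow q).2 (le_of_lt hx : (0 : ℝ) ≤ x) (le_of_lt hy : (0 : ℝ) ≤ y) ha hb hab
  simp only [smul_eq_mul] at hconv ⊢
  calc (a * x + b * y) ^ q / M q ≤ (a * x ^ q + b * y ^ q) / M q :=
        div_le_div_of_nonneg_right hconv (hM.pos q).le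
    _ = a * (x ^ q / M q) + b * (y ^ q / M q) := by ring
    _ ≤ a * maximalTerm M x + b * maximalTerm M y := by
        gcongr
        exacts [hM.pow_div_le_maximalTerm hx q, hM.pow_div_le_maximalTerm hy q]

lemma IsWeightSequence.maximalTerm_eq (hM : IsWeightSequence M) {p : ℕ} {x : ℝ}
    (h₁ : quot M p ≤ x) (h₂ : x ≤ quot M (p + 1)) :
    maximalTerm M x = x ^ (p + 1) / M (p + 1) := by
  have hx : 0 < x := (hM.quot_pos p).trans_le h₁
  refine le_antisymm (ciSup_le ?_) (hM.pow_div_le_maximalTerm hx _)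
  exact hM.pow_div_le_of_quot_le_of_le_quot hx
    (fun k hk => (hM.monotone_quot (Nat.le_of_lt_succ hk)).trans h₁)
    (fun k hk => h₂.trans (hM.monotone_quot hk))

/-- The largest function `φ` on `(0,∞)` with `x ^ q * φ x ≤ M q` for all `q`. -/
noncomputable def extremal (M : ℕ → ℝ) (x : ℝ) : ℂ := ((maximalTerm M x)⁻¹ : ℝ)

lemma IsWeightSequence.norm_extremal (hM : IsWeightSequence M) {x : ℝ} (hx : 0 < x) :
    ‖extremal M x‖ = (maximalTerm M x)⁻¹ :=
  Complex.norm_of_nonneg (inv_pos.2 (hM.maximalTerm_pos hx)).le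

lemma IsWeightSequence.continuousOn_extremal (hM : IsWeightSequence M) :
    ContinuousOn (extremal M) (Ioi 0) :=
  Complex.continuous_ofReal.comp_continuousOn
    (hM.continuousOn_maximalTerm.inv₀ fun _ hx => (hM.maximalTerm_pos hx).ne')

lemma IsWeightSequence.extremal_bound (hM : IsWeightSequence M) (p : ℕ) (x : ℝ)
    (hx : x ∈ Ioi (0 : ℝ)) : x ^ p * ‖extremal M x‖ / (1 ^ p * M p) ≤ 1 := by
  have hT := hM.maximalTerm_pos hx
  have := hM.pow_div_le_maximalTerm hx p
  rw [hM.norm_extremal hx, one_pow, one_mul, mul_div_right_comm, ← div_eq_mul_inv]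
  exact (div_le_one hT).2 this

lemma IsWeightSequence.extremal_mem_spaceC (hM : IsWeightSequence M) :
    extremal M ∈ spaceC M := by
  simp only [spaceC, mem_iUnion]
  exact ⟨1, mem_Ioi.2 one_pos, hM.continuousOn_extremal, 1, hM.extremal_bound⟩

lemma IsWeightSequence.mul_log_le_norm_momentMap_extremal (hM : IsWeightSequence M) (p : ℕ) :
    M (p + 1) * Real.log (quot M (p + 1) / quot M p) ≤ ‖momentMap (extremal M) p‖ := by
  have hle := hM.monotone_quot p.le_succ
  have hint := (integrableOn_and_norm_momentMap_le hM hM.continuousOn_extremal one_pos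
    hM.extremal_bound p).1.norm
  have hsub : Ioc (quot M p) (quot M (p + 1)) ⊆ Ioi 0 := fun x hx => (hM.quot_pos p).trans hx.1
  have hnorm : ∀ x ∈ Ioi (0 : ℝ),
      ‖(x : ℂ) ^ p * extremal M x‖ = x ^ p * (maximalTerm M x)⁻¹ := fun x hx => by
    rw [norm_mul, norm_pow, Complex.norm_of_nonneg (le_of_lt hx), hM.norm_extremal hx]
  -- The integrand is a nonnegative real, so the norm of the moment is the integral of the norm.
  have hmoment : ‖momentMap (extremal M) p‖ = ∫ x in Ioi (0 : ℝ), ‖(x : ℂ) ^ p * extremal M x‖ := by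
    have hnn : 0 ≤ ∫ x in Ioi (0 : ℝ), ‖(x : ℂ) ^ p * extremal M x‖ :=
      integral_nonneg fun _ => norm_nonneg _
    have : momentMap (extremal M) p
        = ((∫ x in Ioi (0 : ℝ), ‖(x : ℂ) ^ p * extremal M x‖ : ℝ) : ℂ) := by
      rw [← integral_complex_ofReal]
      refine setIntegral_congr_fun measurableSet_Ioi fun x hx => ?_
      rw [hnorm x hx, extremal]
      push_cast
      rfl
    rw [this, Complex.norm_of_nonneg hnn]
  rw [hmoment]
  calc M (p + 1) * Real.log (quot M (p + 1) / quot M p)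
      = ∫ x in Ioc (quot M p) (quot M (p + 1)), M (p + 1) * x⁻¹ := by
        rw [integral_const_mul, ← intervalIntegral.integral_of_le hle,
          integral_inv_of_pos (hM.quot_pos _) (hM.quot_pos _)]
    _ = ∫ x in Ioc (quot M p) (quot M (p + 1)), ‖(x : ℂ) ^ p * extremal M x‖ := by
        refine setIntegral_congr_fun measurableSet_Ioc fun x hx => ?_
        have hx0 : 0 < x := hsub hx
        have := hM.pos (p + 1)
        simp only [hnorm x hx0, hM.maximalTerm_eq hx.1.le hx.2, pow_succ]
        field_simp
    _ ≤ ∫ x in Ioi (0 : ℝ), ‖(x : ℂ) ^ p * extremal M x‖ :=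
        setIntegral_mono_set hint (ae_of_all _ fun _ => norm_nonneg _)
          (LE.le.eventuallyLE hsub)

lemma IsWeightSequence.hasShiftedMoments_of_momentMap_extremal_mem (hM : IsWeightSequence M)
    (hmem : momentMap (extremal M) ∈ spaceLambda (shift M)) : HasShiftedMoments M := by
  simp only [spaceLambda, mem_iUnion] at hmem
  obtain ⟨h, hh, C, hC⟩ := hmem
  have hh : 0 < h := hh
  refine ⟨max C 1, max h 2, by positivity, lt_max_of_lt_right one_lt_two, fun p => ?_⟩
  have hM1 := hM.pos (p + 1)
  have h1 := hC p
  rw [shift, div_le_iff₀ (by positivity)] at h1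
  have h2 : M (p + 1) * Real.log (quot M (p + 1) / quot M p) ≤ M (p + 1) * (C * h ^ p) :=
    (hM.mul_log_le_norm_momentMap_extremal p).trans (h1.trans_eq (by ring))
  calc Real.log (quot M (p + 1) / quot M p) ≤ C * h ^ p := le_of_mul_le_mul_left h2 hM1
    _ ≤ max C 1 * max h 2 ^ p := by gcongr <;> exact le_max_left _ _
    _ ≤ max C 1 * max h 2 ^ (p + 1) := by
        gcongr
        exacts [le_max_of_le_right one_le_two, p.le_succ]

end Lower

end StieltjesMoment

theorem mainTheorem3 (M : ℕ → ℝ) (hM : StieltjesMoment.IsWeightSequence M)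
    (hγ : 0 < StieltjesMoment.gammaIndex M) :
    (∀ φ ∈ StieltjesMoment.spaceC M, ∀ p : ℕ,
      MeasureTheory.IntegrableOn (fun x : ℝ => (x : ℂ) ^ p * φ x) (Set.Ioi 0)) ∧
    (StieltjesMoment.momentMap '' StieltjesMoment.spaceC M ⊆
        StieltjesMoment.spaceLambda (StieltjesMoment.shift M) ↔
      StieltjesMoment.HasShiftedMoments M) := by
  refine ⟨fun φ hφ p => ?_, fun hsub => ?_, ?_⟩
  · simp only [StieltjesMoment.spaceC, Set.mem_iUnion] at hφ
    obtain ⟨h, hh, hcont, C, hC⟩ := hφ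
    exact (StieltjesMoment.integrableOn_and_norm_momentMap_le hM hcont hh hC p).1
  · exact hM.hasShiftedMoments_of_momentMap_extremal_mem
      (hsub (Set.mem_image_of_mem _ hM.extremal_mem_spaceC))
  · rintro hsm _ ⟨φ, hφ, rfl⟩
    exact StieltjesMoment.momentMap_mem_spaceLambda hM hsm hφ
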